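/- Let $W$ be the Coxeter group of type $B_n$, with simple reflections $s_1,\dots,s_n$ and Coxeter length $\ell$. For $w\in W$ let $d(w)=\#\{j : \ell(s_jw)<\ell(w)\}$ be its number of left descents. For $I\subseteq\{1,\dots,n\}$ let $W_I=\langle s_i : i\in I\rangle$, and let $w_0(W_I)$ be its unique element of maximal length. For $0\le x\le n$ put $\mathsf{maxw}_0(W,x)=\max\{\ell(w_0(W_I)) : I\subseteq\{1,\dots,n\},\ |I|=x\}$. Call $w\in W$ proper if $\ell(w)\le n+\mathsf{maxw}_0(W,d(w))$. Then the number of proper elements in the Coxeter group of type $B_n$ is at most $2^n\,n!\,e^{-\Omega(n)}$; that is, there are absolute constants $c>0$ and $N$ such that for every $n\ge N$ the Coxeter group of type $B_n$ has at most $2^n\,n!\,e^{-cn}$ proper elements. -/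

import Mathlib

namespace CoxeterSystem

variable {B : Type*} {M : CoxeterMatrix B} {W : Type*} [Group W] (cs : CoxeterSystem M W)

/-- The standard parabolic subgroup `W_I` generated by the simple reflections `s_i`, `i ∈ I`. -/
def parabolic (I : Set B) : Subgroup W := Subgroup.closure (cs.simple '' I)

/-- `w₀` is an element of maximal length of `W_I` (if `W_I` is finite there is exactly one).
The length is that of `W`, which restricts to the length of the Coxeter system `(W_I, S_I)`. -/
def IsLongestIn (I : Set B) (w₀ : W) : Prop :=
  w₀ ∈ cs.parabolic I ∧ ∀ u ∈ cs.parabolic I, cs.length u ≤ cs.length w₀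

/-- `maxw₀(W, x) = max {ℓ(w₀(W_I)) : |I| = x}`. For a finite index type `B` this is the supremum of
a finite set of naturals, nonempty when `W` is finite and `x ≤ |B|`. -/
noncomputable def maxw₀ (x : ℕ) : ℕ :=
  sSup {m : ℕ | ∃ I : Set B, I.ncard = x ∧ ∃ w₀ : W, cs.IsLongestIn I w₀ ∧ m = cs.length w₀}

/-- The number `d(w)` of left descents of `w`. -/
noncomputable def numLeftDescents (w : W) : ℕ := {i : B | cs.IsLeftDescent w i}.ncard

/-- `w` is proper if `ℓ(w) ≤ n + maxw₀(W, d(w))`, where `n` is the number of simple reflections. -/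
def IsProper (w : W) : Prop :=
  cs.length w ≤ Nat.card B + cs.maxw₀ (cs.numLeftDescents w)

end CoxeterSystem

/-! A proper `w` has either many descents or small length, and both are exponentially rare. Letting
`W` act on integer vectors as signed permutations, with `toVector w` the image of `(n, …, 1)`, the
length of `w` is the number of positive roots negative on that vector (`length_eq_inv`), and
descents are read off adjacent coordinates. A parabolic subgroup of rank `x` has lengths at most `x²
+ x` (`maxw₀_le`). Hence if `d(w) < 0.6 n`, properness forces `ℓ(w) ≤ n + 0.36 n² + 0.6 n ≤ 0.4 n²`
for large `n`, well below the mean `n²/2`. Descents at pairwise nonadjacent nodes behave like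
independent fair coins, so a Chernoff bound on the even and on the odd nodes controls `d(w) ≥ 0.6 n`
(`card_numLeftDescents_ge_le`). For a fixed permutation of absolute values, the length is affine in
the independent signs, and a second Chernoff bound controls `ℓ(w) ≤ 0.4 n²` (`card_length_le_le`).
-/

namespace SignedVector

/-! ### Signed vectors and their inversions -/

/-- The action of the `i`-th simple reflection of type `B_n` on integer vectors: it exchanges the
coordinates `i` and `i + 1` if `i + 1 < n`, and negates the coordinate `i` otherwise. -/
def reflect (n i : ℕ) (v : ℕ → ℤ) : ℕ → ℤ := fun k =>
  if i + 1 < n then (if k = i then v (i + 1) else if k = i + 1 then v i else v k)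
  else (if k = i then -v i else v k)

/-- The `i`-th simple root is negative on `v`. -/
def Descent (n i : ℕ) (v : ℕ → ℤ) : Prop :=
  (i + 1 < n → v i < v (i + 1)) ∧ (¬ i + 1 < n → v i < 0)

/-- The number of positive roots of the form `e_i ± e_j` with fixed `i < j` that are negative on
a vector with coordinates `a`, `b` at `i`, `j`. -/
def pairInv (a b : ℤ) : ℕ := (if a < b then 1 else 0) + (if a + b < 0 then 1 else 0)

/-- The number of positive roots of type `B_n` that are negative on `v`. -/
def inv (n : ℕ) (v : ℕ → ℤ) : ℕ :=
  (∑ i ∈ Finset.range n, ∑ j ∈ Finset.range n, if i < j then pairInv (v i) (v j) else 0) +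
    ∑ i ∈ Finset.range n, if v i < 0 then 1 else 0

/-- No root of type `B_n` vanishes on `v`. -/
def Generic (n : ℕ) (v : ℕ → ℤ) : Prop :=
  (∀ i < n, v i ≠ 0) ∧ ∀ i < n, ∀ j < n, i ≠ j → |v i| ≠ |v j|

theorem reflect_reflect (n i : ℕ) (v : ℕ → ℤ) : reflect n i (reflect n i v) = v := by
  funext k
  simp only [reflect]
  grind

theorem reflect_comm {n i j : ℕ} (hi : i < n) (hj : j < n) (h1 : i ≠ j + 1) (h2 : j ≠ i + 1)
    (v : ℕ → ℤ) : reflect n i (reflect n j v) = reflect n j (reflect n i v) := by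
  funext k
  simp only [reflect]
  grind

theorem reflect_braid {n i : ℕ} (hi : i + 2 < n) (v : ℕ → ℤ) :
    reflect n i (reflect n (i + 1) (reflect n i v)) =
      reflect n (i + 1) (reflect n i (reflect n (i + 1) v)) := by
  funext k
  simp only [reflect]
  grind

theorem reflect_braid_last {n i : ℕ} (hi : i + 2 = n) (v : ℕ → ℤ) :
    reflect n i (reflect n (i + 1) (reflect n i (reflect n (i + 1) v))) =
      reflect n (i + 1) (reflect n i (reflect n (i + 1) (reflect n i v))) := by
  funext k
  simp only [reflect]
  grind

theorem reflect_eq_comp_swap {n i : ℕ} (hi : i + 1 < n) (v : ℕ → ℤ) (k : ℕ) :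
    reflect n i v k = v (Equiv.swap i (i + 1) k) := by
  simp only [reflect, Equiv.swap_apply_def, if_pos hi]
  grind

theorem sum_comp_swap {M : Type*} [AddCommMonoid M] {n i : ℕ} (hi : i + 1 < n) (f : ℕ → M) :
    ∑ k ∈ Finset.range n, f (Equiv.swap i (i + 1) k) = ∑ k ∈ Finset.range n, f k := by
  apply Equiv.Perm.sum_comp
  intro a ha
  simp only [Set.mem_ofPred_eq, Equiv.swap_apply_def] at ha
  simp only [Finset.coe_range, Set.mem_Iio]
  grind

/-- The swap permutes all positive roots except `e_i - e_{i+1}`, whose sign it changes. -/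
theorem inv_reflect_of_descent_swap {n i : ℕ} (hi : i + 1 < n) {v : ℕ → ℤ}
    (h : v i < v (i + 1)) : inv n (reflect n i v) + 1 = inv n v := by
  set τ := Equiv.swap i (i + 1) with hτ
  have hττ : ∀ k, τ (τ k) = k := fun k => Equiv.swap_apply_self _ _ _
  have e1 : ∑ k ∈ Finset.range n, (if reflect n i v k < 0 then 1 else 0) =
      ∑ k ∈ Finset.range n, if v k < 0 then 1 else 0 := by
    simp only [reflect_eq_comp_swap hi]
    exact sum_comp_swap hi (fun k => if v k < 0 then 1 else 0)
  have e2 : (∑ a ∈ Finset.range n, ∑ b ∈ Finset.range n,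
        if a < b then pairInv (reflect n i v a) (reflect n i v b) else 0) =
      ∑ a ∈ Finset.range n, ∑ b ∈ Finset.range n,
        if τ a < τ b then pairInv (v a) (v b) else 0 := by
    simp only [reflect_eq_comp_swap hi, ← hτ]
    rw [← sum_comp_swap hi (fun a => ∑ b ∈ Finset.range n,
        if τ a < τ b then pairInv (v a) (v b) else 0)]
    refine Finset.sum_congr rfl fun a _ => ?_
    rw [← sum_comp_swap hi (fun b =>
        if τ (Equiv.swap i (i + 1) a) < τ b then pairInv (v (Equiv.swap i (i + 1) a)) (v b) else 0)]
    refine Finset.sum_congr rfl fun b _ => ?_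
    simp only [← hτ, hττ]
  -- The swap alters the relative order of the pair `i, i + 1` only; the corrections sit on both
  -- sides to avoid subtraction in `ℕ`.
  have key : ∀ a b, (if τ a < τ b then pairInv (v a) (v b) else 0) +
      (if a = i then if b = i + 1 then pairInv (v i) (v (i + 1)) else 0 else 0) =
      (if a < b then pairInv (v a) (v b) else 0) +
      (if a = i + 1 then if b = i then pairInv (v (i + 1)) (v i) else 0 else 0) := by
    intro a b
    simp only [hτ, Equiv.swap_apply_def]
    grind
  have e3 : (∑ a ∈ Finset.range n, ∑ b ∈ Finset.range n,
        if τ a < τ b then pairInv (v a) (v b) else 0) + pairInv (v i) (v (i + 1)) =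
      (∑ a ∈ Finset.range n, ∑ b ∈ Finset.range n,
        if a < b then pairInv (v a) (v b) else 0) + pairInv (v (i + 1)) (v i) := by
    have := Finset.sum_congr (rfl : Finset.range n = Finset.range n) fun a _ =>
      Finset.sum_congr (rfl : Finset.range n = Finset.range n) fun b _ => key a b
    simp only [Finset.sum_add_distrib] at this
    convert this using 2
    · rw [Finset.sum_eq_single i] <;> simp +contextual [hi]
      intro h; omega
    · rw [Finset.sum_eq_single (i + 1)] <;> simp +contextual [hi]
      intro h; omega
  have e4 : pairInv (v i) (v (i + 1)) = pairInv (v (i + 1)) (v i) + 1 := by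
    simp only [pairInv, if_pos h, if_neg h.le.not_gt, add_comm (v (i + 1))]
    ring
  unfold inv
  omega

/-- Negating the last coordinate exchanges `e_a - e_i` with `e_a + e_i`, so only the short root
`e_i` matters. -/
theorem inv_reflect_of_descent_last {n i : ℕ} (hi : i + 1 = n) {v : ℕ → ℤ}
    (h : v i < 0) : inv n (reflect n i v) + 1 = inv n v := by
  have hi' : ¬ i + 1 < n := by omega
  have e2 : (∑ a ∈ Finset.range n, ∑ b ∈ Finset.range n,
        if a < b then pairInv (reflect n i v a) (reflect n i v b) else 0) =
      ∑ a ∈ Finset.range n, ∑ b ∈ Finset.range n,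
        if a < b then pairInv (v a) (v b) else 0 := by
    refine Finset.sum_congr rfl fun a ha => Finset.sum_congr rfl fun b hb => ?_
    simp only [Finset.mem_range] at ha hb
    simp only [reflect, if_neg hi', pairInv]
    grind
  have e1 : (∑ k ∈ Finset.range n, if reflect n i v k < 0 then 1 else 0) + 1 =
      ∑ k ∈ Finset.range n, if v k < 0 then 1 else 0 := by
    subst hi
    rw [Finset.sum_range_succ, Finset.sum_range_succ]
    have : ∑ k ∈ Finset.range i, (if reflect (i + 1) i v k < 0 then 1 else 0) =
        ∑ k ∈ Finset.range i, if v k < 0 then 1 else 0 := by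
      refine Finset.sum_congr rfl fun a ha => ?_
      simp only [Finset.mem_range] at ha
      simp only [reflect]
      grind
    rw [this]
    simp only [reflect]
    grind
  unfold inv
  omega

theorem inv_reflect_of_descent {n i : ℕ} (hi : i < n) {v : ℕ → ℤ} (h : Descent n i v) :
    inv n (reflect n i v) + 1 = inv n v := by
  by_cases hi' : i + 1 < n
  · exact inv_reflect_of_descent_swap hi' (h.1 hi')
  · exact inv_reflect_of_descent_last (by omega) (h.2 hi')

/-- Genericity excludes a simple root vanishing on `v`, when neither `v` nor its reflection has a
descent. -/
theorem Generic.descent_reflect {n i : ℕ} (hi : i < n) {v : ℕ → ℤ} (hv : Generic n v)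
    (h : ¬ Descent n i v) : Descent n i (reflect n i v) := by
  have h0 := hv.1 i hi
  have h1 := hv.2 i hi (i + 1)
  simp only [Descent, reflect] at *
  grind

theorem Generic.inv_reflect_of_not_descent {n i : ℕ} (hi : i < n) {v : ℕ → ℤ}
    (hv : Generic n v) (h : ¬ Descent n i v) : inv n (reflect n i v) = inv n v + 1 := by
  have := inv_reflect_of_descent hi (hv.descent_reflect hi h)
  rw [reflect_reflect] at this
  exact this.symm

theorem Generic.reflect {n i : ℕ} (hi : i < n) {v : ℕ → ℤ} (hv : Generic n v) :
    Generic n (reflect n i v) := by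
  obtain ⟨h0, h1⟩ := hv
  by_cases h : i + 1 < n
  · refine ⟨fun a ha => ?_, fun a ha b hb hab => ?_⟩
    · simp only [SignedVector.reflect]
      grind
    · rw [reflect_eq_comp_swap h, reflect_eq_comp_swap h]
      refine h1 _ ?_ _ ?_ (fun h => hab (Equiv.injective _ h))
      · rw [Equiv.swap_apply_def]; grind
      · rw [Equiv.swap_apply_def]; grind
  · have h2 : ∀ k, |SignedVector.reflect n i v k| = |v k| := by
      intro k
      simp only [SignedVector.reflect]
      grind
    refine ⟨fun a ha => ?_, fun a ha b hb hab => ?_⟩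
    · rw [← abs_pos, h2, abs_pos]; exact h0 a ha
    · rw [h2, h2]; exact h1 a ha b hb hab

theorem descent_reflect_iff {n i j : ℕ} (hij : i ≠ j) (h1 : i ≠ j + 1) (h2 : j ≠ i + 1)
    (v : ℕ → ℤ) : Descent n j (reflect n i v) ↔ Descent n j v := by
  simp only [Descent, reflect]
  grind

/-- Here `v i < v (i+1) < v (i+2)`, and both braid words sort these three entries by descents only.
-/
theorem descent_braid {n i j : ℕ} (hj : j = i + 1) (hn : i + 2 < n) {v : ℕ → ℤ}
    (h1 : Descent n i v) (h2 : Descent n j v) :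
    (Descent n j (reflect n i v) ∧ Descent n i (reflect n j (reflect n i v))) ∧
      Descent n i (reflect n j v) ∧ Descent n j (reflect n i (reflect n j v)) := by
  subst hj
  have a1 := h1.1 (by omega)
  have a2 := h2.1 (by omega)
  refine ⟨⟨⟨?_, ?_⟩, ?_, ?_⟩, ⟨?_, ?_⟩, ?_, ?_⟩ <;> simp only [reflect] <;> grind

theorem descent_braid_last {n i j : ℕ} (hj : j = i + 1) (hn : i + 2 = n) {v : ℕ → ℤ}
    (h1 : Descent n i v) (h2 : Descent n j v) :
    (Descent n j (reflect n i v) ∧ Descent n i (reflect n j (reflect n i v)) ∧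
      Descent n j (reflect n i (reflect n j (reflect n i v)))) ∧
    Descent n i (reflect n j v) ∧ Descent n j (reflect n i (reflect n j v)) ∧
      Descent n i (reflect n j (reflect n i (reflect n j v))) := by
  subst hj hn
  have a1 := h1.1 (by omega)
  have a2 := h2.2 (by omega)
  refine ⟨⟨⟨?_, ?_⟩, ⟨?_, ?_⟩, ?_, ?_⟩, ⟨?_, ?_⟩, ⟨?_, ?_⟩, ?_, ?_⟩ <;>
    simp [reflect] <;> omega

/-- The dominant vector `(n, n - 1, …, 1)`. -/
def base (n : ℕ) : ℕ → ℤ := fun k => if k < n then (n : ℤ) - k else 0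

theorem not_descent_base {n i : ℕ} (hi : i < n) : ¬ Descent n i (base n) := by
  simp only [Descent, base]
  grind

theorem generic_base (n : ℕ) : Generic n (base n) := by
  refine ⟨fun i hi => ?_, fun i hi j hj hij => ?_⟩
  · simp only [base]; grind
  · simp only [base, if_pos hi, if_pos hj]
    rw [abs_of_pos (by omega), abs_of_pos (by omega)]
    omega

theorem inv_base (n : ℕ) : inv n (base n) = 0 := by
  have h1 : ∀ i ∈ Finset.range n, ∀ j ∈ Finset.range n,
      (if i < j then pairInv (base n i) (base n j) else 0) = 0 := by
    intro i hi j hj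
    simp only [Finset.mem_range, base, pairInv] at *
    grind
  have h2 : ∀ i ∈ Finset.range n, (if base n i < 0 then 1 else 0) = 0 := by
    intro i hi
    simp only [Finset.mem_range, base] at *
    grind
  rw [inv, Finset.sum_eq_zero fun i hi => Finset.sum_eq_zero (h1 i hi), Finset.sum_eq_zero h2,
    add_zero]

end SignedVector

/-! ### Length equals inversion number -/

namespace CoxeterSystem

open SignedVector

variable {n : ℕ} {W : Type*} [Group W] (cs : CoxeterSystem (CoxeterMatrix.B n) W)

/-- The reflection `reflect n i` as an element of the endomorphism monoid of integer vectors. -/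
def reflectEnd (n i : ℕ) : Function.End (ℕ → ℤ) := reflect n i

theorem isLiftable_reflect : (CoxeterMatrix.B n).IsLiftable
    (fun i : Fin n => reflectEnd n i) := by
  have sq : ∀ i : Fin n, (reflectEnd n i * reflectEnd n i) = 1 := fun i =>
    funext fun v => reflect_reflect n i v
  have h3 : ∀ i : ℕ, i + 2 < n →
      (reflectEnd n i * reflectEnd n (i + 1)) ^ 3 = 1 ∧
      (reflectEnd n (i + 1) * reflectEnd n i) ^ 3 = 1 := by
    intro i hi
    constructor <;> funext v
    · change reflect n i (reflect n (i + 1) (reflect n i (reflect n (i + 1)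
        (reflect n i (reflect n (i + 1) v))))) = v
      rw [reflect_braid hi, ← reflect_braid hi v]
      simp only [reflect_reflect, reflect_braid hi]
    · change reflect n (i + 1) (reflect n i (reflect n (i + 1) (reflect n i
        (reflect n (i + 1) (reflect n i v))))) = v
      rw [← reflect_braid hi, reflect_braid hi v]
      simp only [reflect_reflect, ← reflect_braid hi]
  have h4 : ∀ i : ℕ, i + 2 = n →
      (reflectEnd n i * reflectEnd n (i + 1)) ^ 4 = 1 ∧
      (reflectEnd n (i + 1) * reflectEnd n i) ^ 4 = 1 := by
    intro i hi
    constructor <;> funext v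
    · change reflect n i (reflect n (i + 1) (reflect n i (reflect n (i + 1)
        (reflect n i (reflect n (i + 1) (reflect n i (reflect n (i + 1) v))))))) = v
      rw [reflect_braid_last hi v]
      simp only [reflect_reflect]
    · change reflect n (i + 1) (reflect n i (reflect n (i + 1) (reflect n i
        (reflect n (i + 1) (reflect n i (reflect n (i + 1) (reflect n i v))))))) = v
      rw [← reflect_braid_last hi v]
      simp only [reflect_reflect]
  intro i j
  simp only [CoxeterMatrix.B, Matrix.of_apply]
  split_ifs with hij hlast hadj
  · rw [hij, sq, one_pow]
  · rcases hlast with ⟨h1, h2⟩ | ⟨h1, h2⟩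
    · have hne := Fin.val_ne_of_ne hij
      have e : (i : ℕ) = j + 1 := by omega
      rw [e]
      exact (h4 j (by omega)).2
    · have hne := Fin.val_ne_of_ne hij
      have e : (j : ℕ) = i + 1 := by omega
      rw [e]
      exact (h4 i (by omega)).1
  · rcases hadj with h | h
    · rw [← h]
      exact (h3 j (by omega)).2
    · rw [← h]
      exact (h3 i (by omega)).1
  · funext v
    push Not at hadj
    change reflect n i (reflect n j (reflect n i (reflect n j v))) = v
    rw [reflect_comm i.2 j.2 (Ne.symm hadj.1) (Ne.symm hadj.2) v]
    simp only [reflect_reflect]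

/-- The action of the Coxeter group of type `B_n` on integer vectors. -/
noncomputable def signedAction : W →* Function.End (ℕ → ℤ) :=
  cs.lift ⟨_, isLiftable_reflect⟩

/-- The image of the dominant vector under a group element. -/
noncomputable def toVector (w : W) : ℕ → ℤ := cs.signedAction w (base n)

@[simp] theorem toVector_one : cs.toVector 1 = base n := by
  simp [toVector, Function.End.one_def]

theorem toVector_simple_mul (i : Fin n) (w : W) :
    cs.toVector (cs.simple i * w) = reflect n i (cs.toVector w) := by
  rw [toVector, map_mul, signedAction, cs.lift_apply_simple isLiftable_reflect]
  rfl

theorem generic_toVector (w : W) : Generic n (cs.toVector w) := by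
  induction w using cs.simple_induction_left with
  | one => simpa using generic_base n
  | mul_simple_left w i ih => rw [toVector_simple_mul]; exact ih.reflect i.2

/-- Each letter of a reduced word raises `inv` by at most one. -/
theorem inv_toVector_le (w : W) : inv n (cs.toVector w) ≤ cs.length w := by
  obtain ⟨ω, hω, rfl⟩ := cs.exists_isReduced w
  rw [hω.eq]
  clear hω
  induction ω with
  | nil => simp [inv_base]
  | cons i ω ih =>
    rw [wordProd_cons, toVector_simple_mul, List.length_cons]
    by_cases h : Descent n i (cs.toVector (cs.wordProd ω))
    · have := inv_reflect_of_descent i.2 h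
      omega
    · have := (cs.generic_toVector _).inv_reflect_of_not_descent i.2 h
      omega

open Classical in
/-- The group element obtained by sorting a vector. -/
noncomputable def ofVector (v : ℕ → ℤ) : W :=
  if h : ∃ i : Fin n, Descent n i v then
    cs.simple h.choose * ofVector (reflect n h.choose v)
  else 1
termination_by inv n v
decreasing_by
  have := inv_reflect_of_descent h.choose.2 h.choose_spec
  omega

theorem length_ofVector_le (v : ℕ → ℤ) : cs.length (cs.ofVector v) ≤ inv n v := by
  induction hN : inv n v using Nat.strong_induction_on generalizing v with
  | _ N ih =>
    rw [ofVector]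
    split_ifs with h
    · have h1 := inv_reflect_of_descent h.choose.2 h.choose_spec
      have h2 := ih _ (by omega) (reflect n h.choose v) rfl
      have h3 := cs.length_mul_le (cs.simple h.choose) (cs.ofVector (reflect n h.choose v))
      rw [length_simple] at h3
      omega
    · simp

theorem simple_mul_comm {i j : Fin n} (hij : i ≠ j) (h1 : (i : ℕ) ≠ j + 1)
    (h2 : (j : ℕ) ≠ i + 1) : cs.simple i * cs.simple j = cs.simple j * cs.simple i := by
  have h := cs.simple_mul_simple_pow i j
  have hM : CoxeterMatrix.B n i j = 2 := by
    simp only [CoxeterMatrix.B, Matrix.of_apply]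
    rw [if_neg hij, if_neg (by omega), if_neg (by omega)]
  rw [hM, pow_two] at h
  rw [eq_inv_of_mul_eq_one_left h]
  simp

theorem simple_braid {i j : Fin n} (hi : (i : ℕ) + 2 < n) (hj : (j : ℕ) = i + 1) :
    cs.simple i * cs.simple j * cs.simple i = cs.simple j * cs.simple i * cs.simple j := by
  have h := cs.simple_mul_simple_pow i j
  have hM : CoxeterMatrix.B n i j = 3 := by
    simp only [CoxeterMatrix.B, Matrix.of_apply]
    rw [if_neg (by rw [Fin.ext_iff]; omega), if_neg (by omega), if_pos (by omega)]
  have h' : (cs.simple i * cs.simple j * cs.simple i) *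
      (cs.simple j * cs.simple i * cs.simple j) = 1 := by
    rw [hM] at h
    simpa [pow_succ, mul_assoc] using h
  rw [eq_inv_of_mul_eq_one_left h']
  simp [mul_assoc]

theorem simple_braid_last {i j : Fin n} (hi : (i : ℕ) + 2 = n) (hj : (j : ℕ) = i + 1) :
    cs.simple i * cs.simple j * cs.simple i * cs.simple j =
      cs.simple j * cs.simple i * cs.simple j * cs.simple i := by
  have h := cs.simple_mul_simple_pow i j
  have hM : CoxeterMatrix.B n i j = 4 := by
    simp only [CoxeterMatrix.B, Matrix.of_apply]
    rw [if_neg (by rw [Fin.ext_iff]; omega), if_pos (by omega)]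
  have h' : (cs.simple i * cs.simple j * cs.simple i * cs.simple j) *
      (cs.simple i * cs.simple j * cs.simple i * cs.simple j) = 1 := by
    rw [hM] at h
    simpa [pow_succ, mul_assoc] using h
  rw [eq_inv_of_mul_eq_one_left h']
  simp [mul_assoc]

/-- Sorting is confluent: after two different first descents, the paths rejoin through the two sides
of a commutation or braid relation, which agree in `W`. Thus the choice in `ofVector` is immaterial.
-/
theorem ofVector_eq_of_descent (v : ℕ → ℤ) (i : Fin n) (hi : Descent n i v) :
    cs.ofVector v = cs.simple i * cs.ofVector (reflect n i v) := by
  induction hN : inv n v using Nat.strong_induction_on generalizing v i with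
  | _ N ih =>
    subst hN
    -- any two descents give the same product
    suffices key : ∀ a b : Fin n, a < b → Descent n a v → Descent n b v →
        cs.simple a * cs.ofVector (reflect n a v) =
          cs.simple b * cs.ofVector (reflect n b v) by
      have h : ∃ i : Fin n, Descent n i v := ⟨i, hi⟩
      rw [ofVector, dif_pos h]
      rcases lt_trichotomy h.choose i with h' | h' | h'
      · exact key _ _ h' h.choose_spec hi
      · rw [h']
      · exact (key _ _ h' hi h.choose_spec).symm
    intro a b hab ha hb
    have hab' : (a : ℕ) < b := hab
    -- The induction hypothesis, returned with the bound needed to apply it again along a braid.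
    have step : ∀ u : ℕ → ℤ, inv n u < inv n v → ∀ c : Fin n, Descent n c u →
        cs.ofVector u = cs.simple c * cs.ofVector (reflect n c u) ∧
          inv n (reflect n c u) < inv n v := fun u hu c hc =>
      ⟨ih _ hu u c hc rfl, by have := inv_reflect_of_descent c.2 hc; omega⟩
    have la : inv n (reflect n a v) < inv n v := by
      have := inv_reflect_of_descent a.2 ha; omega
    have lb : inv n (reflect n b v) < inv n v := by
      have := inv_reflect_of_descent b.2 hb; omega
    by_cases hadj : (b : ℕ) = a + 1
    · by_cases hlast : (a : ℕ) + 2 = n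
      · obtain ⟨⟨d1, d2, d3⟩, d4, d5, d6⟩ := descent_braid_last hadj hlast ha hb
        obtain ⟨ea, la⟩ := step _ la b d1
        obtain ⟨ea', la⟩ := step _ la a d2
        obtain ⟨ea'', la⟩ := step _ la b d3
        obtain ⟨eb, lb⟩ := step _ lb a d4
        obtain ⟨eb', lb⟩ := step _ lb b d5
        obtain ⟨eb'', lb⟩ := step _ lb a d6
        rw [ea, ea', ea'', eb, eb', eb'', hadj, reflect_braid_last hlast]
        simp only [← mul_assoc]
        rw [cs.simple_braid_last hlast hadj]
      · have hlast' : (a : ℕ) + 2 < n := by omega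
        obtain ⟨⟨d1, d2⟩, d3, d4⟩ := descent_braid hadj hlast' ha hb
        obtain ⟨ea, la⟩ := step _ la b d1
        obtain ⟨ea', la⟩ := step _ la a d2
        obtain ⟨eb, lb⟩ := step _ lb a d3
        obtain ⟨eb', lb⟩ := step _ lb b d4
        rw [ea, ea', eb, eb', hadj, reflect_braid hlast']
        simp only [← mul_assoc]
        rw [cs.simple_braid hlast' hadj]
    · have h1 : (a : ℕ) ≠ b + 1 := by omega
      obtain ⟨ea, la⟩ := step _ la b ((descent_reflect_iff hab'.ne h1 hadj v).2 hb)
      obtain ⟨eb, lb⟩ := step _ lb a ((descent_reflect_iff hab'.ne' hadj h1 v).2 ha)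
      rw [ea, eb, reflect_comm a.2 b.2 h1 hadj, ← mul_assoc, ← mul_assoc,
        cs.simple_mul_comm hab.ne h1 hadj]

theorem ofVector_reflect {v : ℕ → ℤ} (hv : Generic n v) (i : Fin n) :
    cs.ofVector (reflect n i v) = cs.simple i * cs.ofVector v := by
  by_cases h : Descent n i v
  · rw [cs.ofVector_eq_of_descent v i h, simple_mul_simple_cancel_left]
  · rw [cs.ofVector_eq_of_descent _ i (hv.descent_reflect i.2 h), reflect_reflect]

/-- This gives faithfulness of the action and, since sorting uses at most `inv` letters, the upper
bound on length. -/
theorem ofVector_toVector (w : W) : cs.ofVector (cs.toVector w) = w := by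
  induction w using cs.simple_induction_left with
  | one =>
    rw [toVector_one, ofVector, dif_neg]
    rintro ⟨i, hi⟩
    exact not_descent_base i.2 hi
  | mul_simple_left w i ih =>
    rw [toVector_simple_mul, cs.ofVector_reflect (cs.generic_toVector w), ih]

theorem toVector_injective : Function.Injective cs.toVector :=
  Function.LeftInverse.injective cs.ofVector_toVector

theorem length_eq_inv (w : W) : cs.length w = inv n (cs.toVector w) := by
  refine le_antisymm ?_ (cs.inv_toVector_le w)
  have := cs.length_ofVector_le (cs.toVector w)
  rwa [ofVector_toVector] at this

theorem isLeftDescent_iff_descent (w : W) (i : Fin n) :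
    cs.IsLeftDescent w i ↔ Descent n i (cs.toVector w) := by
  rw [IsLeftDescent, length_eq_inv, length_eq_inv, toVector_simple_mul]
  by_cases h : Descent n i (cs.toVector w)
  · have := inv_reflect_of_descent i.2 h
    simp only [h, iff_true]
    omega
  · have := (cs.generic_toVector w).inv_reflect_of_not_descent i.2 h
    simp only [h, iff_false]
    omega

theorem isLeftDescent_simple_mul_self (w : W) (i : Fin n) :
    cs.IsLeftDescent (cs.simple i * w) i ↔ ¬ cs.IsLeftDescent w i := by
  rw [IsLeftDescent, IsLeftDescent, simple_mul_simple_cancel_left]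
  have := cs.length_simple_mul_ne w i
  omega

theorem isLeftDescent_simple_mul_iff {i j : Fin n} (hij : i ≠ j) (h1 : (i : ℕ) ≠ j + 1)
    (h2 : (j : ℕ) ≠ i + 1) (w : W) :
    cs.IsLeftDescent (cs.simple i * w) j ↔ cs.IsLeftDescent w j := by
  rw [isLeftDescent_iff_descent, isLeftDescent_iff_descent, toVector_simple_mul]
  exact descent_reflect_iff (Fin.val_ne_of_ne hij) h1 h2 _

end CoxeterSystem

/-! ### Lengths in parabolic subgroups -/

namespace SignedVector

/-- The coordinates `0, …, k` of `v` are positive and dominate the later ones, for all `k ∉ J`. -/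
def DominantOutside (n : ℕ) (J : Finset ℕ) (v : ℕ → ℤ) : Prop :=
  ∀ k < n, k ∉ J → ∀ i ≤ k, 0 < v i ∧ ∀ j, k < j → j < n → |v j| < v i

theorem dominantOutside_base (n : ℕ) (J : Finset ℕ) : DominantOutside n J (base n) := by
  intro k hk _ i hi
  refine ⟨?_, fun j hj hjn => ?_⟩
  · rw [base, if_pos (by omega)]; omega
  · rw [base, base, if_pos hjn, if_pos (by omega), abs_of_pos (by omega)]; omega

/-- Since `m ≠ k`, the reflection permutes coordinates within the blocks `≤ k` and `> k`, or negates
the last one, which lies beyond `k`. -/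
theorem DominantOutside.reflect {n m : ℕ} (hm : m < n) {J : Finset ℕ} (hmJ : m ∈ J)
    {v : ℕ → ℤ} (hv : DominantOutside n J v) : DominantOutside n J (reflect n m v) := by
  intro k hk hkJ i hi
  have hmk : m ≠ k := by rintro rfl; exact hkJ hmJ
  have h := hv k hk hkJ
  by_cases hmn : m + 1 < n
  · rw [reflect_eq_comp_swap hmn]
    have hi' : Equiv.swap m (m + 1) i ≤ k := by
      rw [Equiv.swap_apply_def]; split_ifs <;> omega
    refine ⟨(h _ hi').1, fun j hj hjn => ?_⟩
    rw [reflect_eq_comp_swap hmn]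
    refine (h _ hi').2 _ ?_ ?_ <;> rw [Equiv.swap_apply_def] <;> split_ifs <;> omega
  · have h1 : SignedVector.reflect n m v i = v i := by
      rw [SignedVector.reflect, if_neg hmn, if_neg (by omega)]
    rw [h1]
    refine ⟨(h i hi).1, fun j hj hjn => ?_⟩
    have h2 : |SignedVector.reflect n m v j| = |v j| := by
      rw [SignedVector.reflect, if_neg hmn]
      split_ifs with h
      · rw [h, abs_neg]
      · rfl
    rw [h2]
    exact (h i hi).2 j hj hjn

/-- The negative long roots inject into `J × J`: differences `e_i - e_j` go to its weakly increasing
pairs, sums `e_i + e_j` to its strictly decreasing ones. The short roots add at most `|J|`. -/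
theorem DominantOutside.inv_le {n : ℕ} {J : Finset ℕ} {v : ℕ → ℤ}
    (hv : DominantOutside n J v) : inv n v ≤ J.card ^ 2 + J.card := by
  set R : Finset (ℕ × ℕ) := Finset.range n ×ˢ Finset.range n with hR
  have hsum : inv n v = (R.filter fun p => p.1 < p.2 ∧ v p.1 < v p.2).card +
      (R.filter fun p => p.1 < p.2 ∧ v p.1 + v p.2 < 0).card +
      ((Finset.range n).filter fun i => v i < 0).card := by
    simp only [Finset.card_filter, hR, Finset.sum_product, inv, ← Finset.sum_add_distrib]
    refine Finset.sum_congr rfl fun i _ => congrArg (· + _) (Finset.sum_congr rfl fun j _ => ?_)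
    by_cases h : i < j <;> simp [h, pairInv]
  have hA : (R.filter fun p => p.1 < p.2 ∧ v p.1 < v p.2).card ≤
      ((J ×ˢ J).filter fun p => p.1 ≤ p.2).card := by
    -- The shift is needed because `e_i - e_j` has simple support `i, …, j - 1`, so `j` itself need
    -- not lie in `J`.
    refine Finset.card_le_card_of_injOn (fun p => (p.1, p.2 - 1)) ?_ ?_
    · rintro ⟨i, j⟩ hij
      simp only [R, Finset.coe_filter, Finset.mem_product, Finset.mem_range,
        Set.mem_ofPred_eq] at hij ⊢
      obtain ⟨⟨hi, hj⟩, hlt, hvij⟩ := hij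
      refine ⟨⟨?_, ?_⟩, by omega⟩
      · by_contra hiJ
        have := (hv i hi hiJ i le_rfl).2 j hlt hj
        have := le_abs_self (v j)
        omega
      · by_contra hjJ
        have := (hv (j - 1) (by omega) hjJ i (by omega)).2 j (by omega) hj
        have := le_abs_self (v j)
        omega
    · rintro ⟨i, j⟩ hij ⟨i', j'⟩ hij' h
      simp only [Finset.coe_filter, Set.mem_ofPred_eq, Prod.mk.injEq] at hij hij' h ⊢
      omega
  have hB : (R.filter fun p => p.1 < p.2 ∧ v p.1 + v p.2 < 0).card ≤
      ((J ×ˢ J).filter fun p => ¬ p.1 ≤ p.2).card := by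
    refine Finset.card_le_card_of_injOn (fun p => (p.2, p.1)) ?_ ?_
    · rintro ⟨i, j⟩ hij
      simp only [R, Finset.coe_filter, Finset.mem_product, Finset.mem_range,
        Set.mem_ofPred_eq] at hij ⊢
      obtain ⟨⟨hi, hj⟩, hlt, hvij⟩ := hij
      refine ⟨⟨?_, ?_⟩, by omega⟩
      · by_contra hjJ
        have h1 := (hv j hj hjJ j le_rfl).1
        have h2 := (hv j hj hjJ i hlt.le).1
        omega
      · by_contra hiJ
        have := (hv i hi hiJ i le_rfl).2 j hlt hj
        have := neg_abs_le (v j)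
        omega
    · rintro ⟨i, j⟩ hij ⟨i', j'⟩ hij' h
      simp only [Prod.mk.injEq] at h ⊢
      omega
  have hC : ((Finset.range n).filter fun i => v i < 0).card ≤ J.card := by
    refine Finset.card_le_card fun i hi => ?_
    simp only [Finset.mem_filter, Finset.mem_range] at hi
    by_contra hiJ
    have := (hv i hi.1 hiJ i le_rfl).1
    omega
  have hAB := Finset.card_filter_add_card_filter_not (s := J ×ˢ J) (fun p => p.1 ≤ p.2)
  rw [Finset.card_product, ← pow_two] at hAB
  omega

end SignedVector

namespace CoxeterSystem

open SignedVector

variable {n : ℕ} {W : Type*} [Group W] (cs : CoxeterSystem (CoxeterMatrix.B n) W)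

theorem length_le_of_mem_parabolic {I : Set (Fin n)} {u : W} (hu : u ∈ cs.parabolic I) :
    cs.length u ≤ I.ncard ^ 2 + I.ncard := by
  classical
  set J : Finset ℕ := I.toFinset.map Fin.valEmbedding with hJ
  have hcard : J.card = I.ncard := by rw [hJ, Finset.card_map, Set.ncard_eq_toFinset_card']
  have hmem : ∀ i ∈ I, (i : ℕ) ∈ J := fun i hi => by
    simp only [hJ, Finset.mem_map, Set.mem_toFinset]
    exact ⟨i, hi, rfl⟩
  rw [length_eq_inv, ← hcard]
  apply DominantOutside.inv_le
  rw [parabolic] at hu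
  induction hu using Subgroup.closure_induction_left with
  | one => rw [toVector_one]; exact dominantOutside_base n J
  | mul_left x hx y hy ih =>
    obtain ⟨i, hi, rfl⟩ := hx
    rw [toVector_simple_mul]
    exact ih.reflect i.2 (hmem i hi)
  | inv_mul_cancel x hx y hy ih =>
    obtain ⟨i, hi, rfl⟩ := hx
    rw [inv_simple, toVector_simple_mul]
    exact ih.reflect i.2 (hmem i hi)

theorem maxw₀_le (x : ℕ) : cs.maxw₀ x ≤ x ^ 2 + x := by
  -- An upper bound on the set suffices, even if it is empty, since `sSup ∅ = 0` in `ℕ`.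
  refine csSup_le' ?_
  rintro m ⟨I, rfl, w₀, hw₀, rfl⟩
  exact cs.length_le_of_mem_parabolic hw₀.1

end CoxeterSystem

/-! ### Many descents are rare -/

namespace CoxeterSystem

variable {n : ℕ} {W : Type*} [Group W] (cs : CoxeterSystem (CoxeterMatrix.B n) W)

open Classical in
/-- The number of left descents of `w` in `S`. -/
noncomputable def descentsIn (S : Finset (Fin n)) (w : W) : ℕ :=
  (S.filter fun i => cs.IsLeftDescent w i).card

/-- Left multiplication by `s_a` toggles the descent at `a` and fixes those at the other,
nonadjacent nodes of `S`. Pairing `w` with `s_a w` thus yields a factor `(1 + t) / 2` per node. -/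
theorem sum_pow_descentsIn [Fintype W] (S : Finset (Fin n))
    (hS : ∀ i ∈ S, ∀ j ∈ S, (j : ℕ) ≠ i + 1) (t : ℝ) :
    ∑ w : W, t ^ cs.descentsIn S w = Fintype.card W * ((1 + t) / 2) ^ S.card := by
  classical
  induction S using Finset.induction_on with
  | empty => simp [descentsIn]
  | insert a S ha ih =>
    have ih := ih fun i hi j hj =>
      hS i (Finset.mem_insert_of_mem hi) j (Finset.mem_insert_of_mem hj)
    have hinv : ∀ w, cs.descentsIn S (cs.simple a * w) = cs.descentsIn S w := by
      intro w
      refine congrArg Finset.card (Finset.filter_congr fun j hj => ?_)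
      refine cs.isLeftDescent_simple_mul_iff (by rintro rfl; exact ha hj) ?_ ?_ w
      · exact hS j (Finset.mem_insert_of_mem hj) a (Finset.mem_insert_self a S)
      · exact hS a (Finset.mem_insert_self a S) j (Finset.mem_insert_of_mem hj)
    have hins : ∀ w, t ^ cs.descentsIn (insert a S) w =
        (if cs.IsLeftDescent w a then t else 1) * t ^ cs.descentsIn S w := by
      intro w
      rw [descentsIn, Finset.filter_insert]
      split_ifs with h
      · rw [Finset.card_insert_of_notMem (by simp [ha]), pow_succ']
        rfl
      · rw [one_mul]
        rfl
    have hpair : ∀ w, t ^ cs.descentsIn (insert a S) w +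
        t ^ cs.descentsIn (insert a S) (cs.simple a * w) = (1 + t) * t ^ cs.descentsIn S w := by
      intro w
      rw [hins, hins, hinv, isLeftDescent_simple_mul_self]
      by_cases h : cs.IsLeftDescent w a
      · simp only [h, if_true, not_true, if_false]; ring
      · simp only [h, if_false, not_false_eq_true, if_true]; ring
    have hshift : ∑ w : W, t ^ cs.descentsIn (insert a S) (cs.simple a * w) =
        ∑ w : W, t ^ cs.descentsIn (insert a S) w :=
      Equiv.sum_comp (Equiv.mulLeft (cs.simple a)) fun w => t ^ cs.descentsIn (insert a S) w
    have h2 := Finset.sum_congr (rfl : (Finset.univ : Finset W) = Finset.univ) fun w _ => hpair w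
    rw [Finset.sum_add_distrib, hshift, ← Finset.mul_sum, ih] at h2
    rw [Finset.card_insert_of_notMem ha, pow_succ]
    linarith

theorem one_add_exp_div_two_le (a : ℝ) : (1 + Real.exp a) / 2 ≤ Real.exp (a / 2 + a ^ 2 / 8) := by
  have h := Real.cosh_le_exp_half_sq (a / 2)
  have e : (1 + Real.exp a) / 2 = Real.exp (a / 2) * Real.cosh (a / 2) := by
    rw [Real.cosh_eq, mul_div_assoc', mul_add, ← Real.exp_add, ← Real.exp_add]
    simp
    ring
  rw [e, Real.exp_add]
  have h' : a ^ 2 / 8 = (a / 2) ^ 2 / 2 := by ring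
  rw [h']
  gcongr

/-- Chernoff with `t = exp 0.4`: the threshold contributes `0.4 · 0.3 n = 0.12 n`, and each of at
most `(n + 1) / 2` nodes costs `0.4 / 2 + 0.4² / 8 = 0.22`. -/
theorem card_descentsIn_ge_le [Fintype W] (S : Finset (Fin n))
    (hS : ∀ i ∈ S, ∀ j ∈ S, (j : ℕ) ≠ i + 1) (hcard : 2 * S.card ≤ n + 1) :
    ({w : W | (0.3 : ℝ) * n ≤ cs.descentsIn S w}.ncard : ℝ) ≤
      Fintype.card W * Real.exp (0.11 - 0.01 * n) := by
  classical
  have hcard' : (2 : ℝ) * S.card ≤ n + 1 := by exact_mod_cast hcard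
  have h1 : ({w : W | (0.3 : ℝ) * n ≤ cs.descentsIn S w}.ncard : ℝ) * Real.exp (0.12 * n) ≤
      ∑ w : W, Real.exp 0.4 ^ cs.descentsIn S w := by
    rw [Set.ncard_eq_toFinset_card', ← nsmul_eq_mul]
    refine (Finset.card_nsmul_le_sum _ (fun w => Real.exp 0.4 ^ cs.descentsIn S w) _ ?_).trans
      (Finset.sum_le_sum_of_subset_of_nonneg (Finset.subset_univ _) fun _ _ _ => by positivity)
    intro w hw
    simp only [Set.mem_toFinset, Set.mem_ofPred_eq] at hw
    rw [← Real.exp_nat_mul]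
    exact Real.exp_le_exp.2 (by linarith)
  rw [cs.sum_pow_descentsIn S hS] at h1
  have h2 : ((1 + Real.exp 0.4) / 2) ^ S.card ≤ Real.exp (0.11 * n + 0.11) := by
    refine (pow_le_pow_left₀ (by positivity) (one_add_exp_div_two_le 0.4) _).trans ?_
    rw [← Real.exp_nat_mul]
    gcongr
    linarith
  have h3 : Real.exp (0.11 - 0.01 * n) * Real.exp (0.12 * n) = Real.exp (0.11 * n + 0.11) := by
    rw [← Real.exp_add]; ring_nf
  refine le_of_mul_le_mul_right ?_ (Real.exp_pos (0.12 * n))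
  rw [mul_assoc, h3]
  exact h1.trans (by gcongr)

theorem card_numLeftDescents_ge_le [Fintype W] :
    ({w : W | (0.6 : ℝ) * n ≤ cs.numLeftDescents w}.ncard : ℝ) ≤
      2 * (Fintype.card W * Real.exp (0.11 - 0.01 * n)) := by
  classical
  -- Each parity class is free of adjacent nodes, and one of them must carry half of the `0.6 n`
  -- descents.
  set E : Finset (Fin n) := Finset.univ.filter fun i => (i : ℕ) % 2 = 0 with hE
  set O : Finset (Fin n) := Finset.univ.filter fun i => ¬ (i : ℕ) % 2 = 0 with hO
  have hsplit : ∀ w, cs.numLeftDescents w = cs.descentsIn E w + cs.descentsIn O w := by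
    intro w
    rw [numLeftDescents, Set.ncard_eq_toFinset_card', descentsIn, descentsIn, hE, hO,
      Finset.filter_filter, Finset.filter_filter]
    rw [← Finset.card_filter_add_card_filter_not (fun i : Fin n => (i : ℕ) % 2 = 0)]
    congr 2 <;> ext i <;> simp [and_comm]
  have hEc : 2 * E.card ≤ n + 1 := by
    have : E.card ≤ (Finset.range ((n + 1) / 2)).card := by
      refine Finset.card_le_card_of_injOn (fun i => (i : ℕ) / 2) ?_ ?_
      · intro i hi
        simp only [hE, Finset.coe_filter, Finset.mem_univ, true_and, Set.mem_ofPred_eq,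
          Finset.coe_range, Set.mem_Iio] at hi ⊢
        omega
      · intro i hi j hj h
        simp only [hE, Finset.coe_filter, Finset.mem_univ, true_and, Set.mem_ofPred_eq] at hi hj h
        rw [Fin.ext_iff]
        omega
    rw [Finset.card_range] at this
    omega
  have hOc : 2 * O.card ≤ n + 1 := by
    have : O.card ≤ (Finset.range ((n + 1) / 2)).card := by
      refine Finset.card_le_card_of_injOn (fun i => (i : ℕ) / 2) ?_ ?_
      · intro i hi
        simp only [hO, Finset.coe_filter, Finset.mem_univ, true_and, Set.mem_ofPred_eq,
          Finset.coe_range, Set.mem_Iio] at hi ⊢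
        omega
      · intro i hi j hj h
        simp only [hO, Finset.coe_filter, Finset.mem_univ, true_and, Set.mem_ofPred_eq] at hi hj h
        rw [Fin.ext_iff]
        omega
    rw [Finset.card_range] at this
    omega
  have hEb := cs.card_descentsIn_ge_le E (fun i hi j hj => by
    simp only [hE, Finset.mem_filter] at hi hj; omega) hEc
  have hOb := cs.card_descentsIn_ge_le O (fun i hi j hj => by
    simp only [hO, Finset.mem_filter] at hi hj; omega) hOc
  have hsub : {w : W | (0.6 : ℝ) * n ≤ cs.numLeftDescents w} ⊆
      {w : W | (0.3 : ℝ) * n ≤ cs.descentsIn E w} ∪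
        {w : W | (0.3 : ℝ) * n ≤ cs.descentsIn O w} := by
    intro w hw
    simp only [Set.mem_union, Set.mem_ofPred_eq, hsplit, Nat.cast_add] at hw ⊢
    by_contra! h
    linarith [h.1, h.2]
  have hle := (Set.ncard_le_ncard hsub (Set.toFinite _)).trans (Set.ncard_union_le _ _)
  have hle' : ({w : W | (0.6 : ℝ) * n ≤ cs.numLeftDescents w}.ncard : ℝ) ≤
      {w : W | (0.3 : ℝ) * n ≤ cs.descentsIn E w}.ncard +
        {w : W | (0.3 : ℝ) * n ≤ cs.descentsIn O w}.ncard := by exact_mod_cast hle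
  linarith

end CoxeterSystem

/-! ### Small inversion numbers are rare -/

namespace SignedVector

/-- The sign attached to a Boolean, with `true` negative. -/
def boolSign (b : Bool) : ℤ := if b then -1 else 1

/-- The vector whose `i`-th coordinate has absolute value `n - p i` and sign given by `ε i`. -/
def ofPerm {n : ℕ} (p : Equiv.Perm (Fin n)) (ε : Fin n → Bool) : ℕ → ℤ := fun k =>
  if h : k < n then boolSign (ε ⟨k, h⟩) * (n - (p ⟨k, h⟩ : ℕ)) else 0

/-- The weight with which the sign of the `i`-th coordinate enters the inversion number. -/
def signWeight {n : ℕ} (p : Equiv.Perm (Fin n)) (i : Fin n) : ℕ :=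
  1 + 2 * (Finset.univ.filter fun j => i < j ∧ p i < p j).card

theorem exists_ofPerm_base (n : ℕ) :
    ∃ x : Equiv.Perm (Fin n) × (Fin n → Bool), base n = ofPerm x.1 x.2 := by
  refine ⟨(1, fun _ => false), funext fun k => ?_⟩
  simp [base, ofPerm, boolSign]

theorem exists_ofPerm_reflect {n i : ℕ} (hi : i < n) (p : Equiv.Perm (Fin n))
    (ε : Fin n → Bool) :
    ∃ x : Equiv.Perm (Fin n) × (Fin n → Bool), reflect n i (ofPerm p ε) = ofPerm x.1 x.2 := by
  by_cases h : i + 1 < n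
  · refine ⟨(p * Equiv.swap ⟨i, hi⟩ ⟨i + 1, h⟩, ε ∘ Equiv.swap ⟨i, hi⟩ ⟨i + 1, h⟩),
      funext fun k => ?_⟩
    simp only [reflect, if_pos h, ofPerm, Equiv.Perm.mul_apply, Function.comp_apply]
    by_cases hk : k < n
    · rcases eq_or_ne k i with rfl | h1
      · simp [h, hk]
      · rcases eq_or_ne k (i + 1) with rfl | h2
        · simp [h, hi]
        · simp only [if_neg h1, if_neg h2, dif_pos hk]
          rw [Equiv.swap_apply_of_ne_of_ne (by simpa using h1) (by simpa using h2)]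
    · have h1 : k ≠ i := by omega
      have h2 : k ≠ i + 1 := by omega
      simp [h1, h2, hk]
  · refine ⟨(p, Function.update ε ⟨i, hi⟩ (!ε ⟨i, hi⟩)), funext fun k => ?_⟩
    simp only [reflect, if_neg h, ofPerm]
    rcases eq_or_ne k i with rfl | h1
    · simp only [hi, dif_pos, if_true, Function.update_self]
      cases ε ⟨k, hi⟩ <;> simp [boolSign]
    · by_cases hk : k < n
      · simp only [if_neg h1, dif_pos hk]
        rw [Function.update_of_ne (by simpa using h1)]
      · simp [h1, hk]

/-- The entry of larger absolute value decides the signs of `v_i ± v_j`. If it is `v_i`, the count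
is 0 or 2 according to `ε i`; if it is `v_j`, exactly one root is negative. The sign of the smaller
entry never matters, which makes `inv` affine in the signs. -/
theorem two_mul_pairInv {n : ℕ} (p : Equiv.Perm (Fin n)) (ε : Fin n → Bool) {i j : Fin n}
    (hij : i < j) : 2 * (pairInv (ofPerm p ε i) (ofPerm p ε j) : ℤ) =
      2 - 2 * (boolSign (ε i) * if p i < p j then 1 else 0) := by
  have hne : (p i : ℕ) ≠ p j := Fin.val_ne_of_ne fun h => hij.ne (p.injective h)
  have h1 := (p i).2
  have h2 := (p j).2
  have h3 : p i < p j ↔ (p i : ℕ) < p j := Iff.rfl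
  simp only [ofPerm, i.2, j.2, dif_pos, Fin.eta, pairInv, h3]
  cases ε i <;> cases ε j <;> simp only [boolSign] <;> grind

theorem two_mul_neg_count {n : ℕ} (p : Equiv.Perm (Fin n)) (ε : Fin n → Bool) (i : Fin n) :
    2 * (if ofPerm p ε i < 0 then 1 else 0 : ℤ) = 1 - boolSign (ε i) := by
  have h1 := (p i).2
  simp only [ofPerm, i.2, dif_pos, Fin.eta]
  cases ε i <;> simp only [boolSign] <;> grind

theorem two_mul_sum_lt (n : ℕ) :
    ∑ i : Fin n, ∑ j : Fin n, (if i < j then 2 else 0 : ℤ) = n ^ 2 - n := by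
  have h1 : ∑ i : Fin n, ∑ j : Fin n, (if i < j then 1 else 0 : ℤ) =
      ∑ i : Fin n, ∑ j : Fin n, (if j < i then 1 else 0 : ℤ) := Finset.sum_comm
  have h2 : ∑ i : Fin n, ∑ j : Fin n, ((if i < j then 1 else 0) + (if j < i then 1 else 0) +
      (if i = j then 1 else 0) : ℤ) = ∑ i : Fin n, ∑ j : Fin n, 1 := by
    refine Finset.sum_congr rfl fun i _ => Finset.sum_congr rfl fun j _ => ?_
    rcases lt_trichotomy i j with h | h | h
    · simp [h, h.not_gt, h.ne]
    · simp [h]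
    · simp [h, h.not_gt, h.ne']
  have h3 : ∑ i : Fin n, ∑ j : Fin n, (if i < j then 2 else 0 : ℤ) =
      2 * ∑ i : Fin n, ∑ j : Fin n, (if i < j then 1 else 0 : ℤ) := by
    simp only [Finset.mul_sum, mul_ite, mul_one, mul_zero]
  simp only [Finset.sum_add_distrib, ← h1] at h2
  simp at h2
  rw [h3]
  simp
  linarith

theorem two_mul_inv_ofPerm {n : ℕ} (p : Equiv.Perm (Fin n)) (ε : Fin n → Bool) :
    2 * (inv n (ofPerm p ε) : ℤ) = n ^ 2 - ∑ i, boolSign (ε i) * signWeight p i := by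
  have h1 : 2 * (inv n (ofPerm p ε) : ℤ) =
      ∑ i : Fin n, ∑ j : Fin n, ((if i < j then 2 else 0) -
        2 * (boolSign (ε i) * if i < j ∧ p i < p j then 1 else 0)) +
      ∑ i : Fin n, (1 - boolSign (ε i)) := by
    rw [inv, Nat.cast_add, mul_add, Finset.sum_range, Finset.sum_range]
    simp only [Finset.sum_range, Nat.cast_sum, Finset.mul_sum]
    congr 1
    · refine Finset.sum_congr rfl fun i _ => Finset.sum_congr rfl fun j _ => ?_
      by_cases hij : i < j
      · rw [if_pos (Fin.lt_def.1 hij), two_mul_pairInv p ε hij]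
        simp [hij]
      · rw [if_neg (fun h => hij (Fin.lt_def.2 h))]
        simp [hij]
    · refine Finset.sum_congr rfl fun i _ => ?_
      rw [← two_mul_neg_count p ε i]
      push_cast
      rfl
  rw [h1]
  simp only [Finset.sum_sub_distrib, two_mul_sum_lt, ← Finset.mul_sum, signWeight,
    Finset.card_filter, Nat.cast_add, Nat.cast_mul, Nat.cast_sum, mul_add, Finset.sum_add_distrib]
  simp only [Finset.mul_sum]
  simp
  ring_nf

theorem signWeight_le {n : ℕ} (p : Equiv.Perm (Fin n)) (i : Fin n) : signWeight p i ≤ 2 * n := by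
  have h : (Finset.univ.filter fun j => i < j ∧ p i < p j).card <
      (Finset.univ : Finset (Fin n)).card :=
    Finset.card_lt_card (Finset.filter_ssubset.2 ⟨i, Finset.mem_univ i, by simp⟩)
  rw [Finset.card_univ, Fintype.card_fin] at h
  rw [signWeight]
  omega

/-- A Chernoff bound for weighted sums of independent signs. -/
theorem card_weighted_signs_le {n : ℕ} (hn : 0 < n) (a : Fin n → ℝ) (h0 : ∀ i, 0 ≤ a i)
    (ha : ∀ i, a i ≤ 2 * n) :
    ((Finset.univ.filter fun ε : Fin n → Bool =>
      (0.2 : ℝ) * n ^ 2 ≤ ∑ i, (boolSign (ε i) : ℝ) * a i).card : ℝ) ≤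
      2 ^ n * Real.exp (-(0.005 * n)) := by
  have hn' : (0 : ℝ) < n := by exact_mod_cast hn
  -- With this `r` the threshold contributes `r · 0.2 n² = 0.01 n`, while `r · a i ≤ 0.1` keeps each
  -- cosh below `exp (0.1² / 2) = exp 0.005`.
  set r : ℝ := 0.05 / n with hr
  have hr0 : 0 ≤ r := by positivity
  have h1 : ((Finset.univ.filter fun ε : Fin n → Bool =>
      (0.2 : ℝ) * n ^ 2 ≤ ∑ i, (boolSign (ε i) : ℝ) * a i).card : ℝ) * Real.exp (0.01 * n) ≤
      ∑ ε : Fin n → Bool, ∏ i, Real.exp (r * (boolSign (ε i) * a i)) := by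
    rw [← nsmul_eq_mul]
    refine (Finset.card_nsmul_le_sum _
      (fun ε : Fin n → Bool => ∏ i, Real.exp (r * (boolSign (ε i) * a i))) _ ?_).trans
      (Finset.sum_le_sum_of_subset_of_nonneg (Finset.subset_univ _) fun _ _ _ => by positivity)
    intro ε hε
    rw [Finset.mem_filter] at hε
    rw [← Real.exp_sum, ← Finset.mul_sum]
    refine Real.exp_le_exp.2 (le_trans (le_of_eq ?_) (mul_le_mul_of_nonneg_left hε.2 hr0))
    rw [hr]
    field_simp
    norm_num
  have h2 : ∑ ε : Fin n → Bool, ∏ i, Real.exp (r * (boolSign (ε i) * a i)) =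
      ∏ i, (2 * Real.cosh (r * a i)) := by
    have := Finset.prod_univ_sum (fun _ : Fin n => (Finset.univ : Finset Bool))
      (fun i b => Real.exp (r * (boolSign b * a i)))
    rw [Fintype.piFinset_univ] at this
    rw [← this]
    refine Finset.prod_congr rfl fun i _ => ?_
    rw [Real.cosh_eq, Fintype.sum_bool]
    simp only [boolSign]
    simp
    ring_nf
  have h3 : ∏ i, (2 * Real.cosh (r * a i)) ≤ 2 ^ n * Real.exp (0.005 * n) := by
    have : ∀ i ∈ (Finset.univ : Finset (Fin n)),
        2 * Real.cosh (r * a i) ≤ 2 * Real.exp 0.005 := by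
      intro i _
      refine mul_le_mul_of_nonneg_left ((Real.cosh_le_exp_half_sq _).trans ?_) (by norm_num)
      refine Real.exp_le_exp.2 ?_
      have hra : r * a i ≤ 0.1 := by
        refine (mul_le_mul_of_nonneg_left (ha i) hr0).trans (le_of_eq ?_)
        rw [hr]
        field_simp
        norm_num
      have hra0 : 0 ≤ r * a i := mul_nonneg hr0 (h0 i)
      nlinarith
    refine (Finset.prod_le_prod (fun i _ => by positivity) this).trans (le_of_eq ?_)
    rw [Finset.prod_const, Finset.card_univ, Fintype.card_fin, mul_pow, ← Real.exp_nat_mul]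
    ring_nf
  have h4 : Real.exp (-(0.005 * n)) * Real.exp (0.01 * n) = Real.exp (0.005 * n) := by
    rw [← Real.exp_add]; congr 1; ring
  refine le_of_mul_le_mul_right ?_ (Real.exp_pos (0.01 * n))
  rw [mul_assoc, h4]
  exact h1.trans (h2.le.trans h3)

theorem card_inv_ofPerm_le {n : ℕ} (hn : 0 < n) :
    ((Finset.univ.filter fun x : Equiv.Perm (Fin n) × (Fin n → Bool) =>
      (inv n (ofPerm x.1 x.2) : ℝ) ≤ 0.4 * n ^ 2).card : ℝ) ≤
      2 ^ n * n.factorial * Real.exp (-(0.005 * n)) := by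
  have hfib : ∀ p : Equiv.Perm (Fin n), ∑ ε : Fin n → Bool,
      (if (inv n (ofPerm p ε) : ℝ) ≤ 0.4 * n ^ 2 then (1 : ℝ) else 0) ≤
      2 ^ n * Real.exp (-(0.005 * n)) := by
    intro p
    rw [← Finset.sum_filter, Finset.sum_const, nsmul_eq_mul, mul_one]
    refine le_trans ?_ (card_weighted_signs_le hn (fun i => (signWeight p i : ℝ))
      (fun i => Nat.cast_nonneg _) fun i => by exact_mod_cast signWeight_le p i)
    refine Nat.cast_le.2 (Finset.card_le_card fun ε hε => ?_)
    rw [Finset.mem_filter] at hε ⊢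
    -- From `inv ≤ 0.4 n²`, the weighted sign sum `n² - 2 inv` is at least `0.2 n²`.
    refine ⟨Finset.mem_univ _, ?_⟩
    have h : 2 * (inv n (ofPerm p ε) : ℝ) =
        n ^ 2 - ∑ i, (boolSign (ε i) : ℝ) * signWeight p i := by
      exact_mod_cast two_mul_inv_ofPerm p ε
    linarith [hε.2]
  rw [Finset.card_filter, Nat.cast_sum, ← Finset.univ_product_univ, Finset.sum_product]
  simp only [Nat.cast_ite, Nat.cast_one, Nat.cast_zero]
  refine (Finset.sum_le_sum fun p _ => hfib p).trans (le_of_eq ?_)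
  rw [Finset.sum_const, Finset.card_univ, Fintype.card_perm, Fintype.card_fin, nsmul_eq_mul]
  ring

end SignedVector

/-! ### Counting proper elements -/

namespace CoxeterSystem

open SignedVector

variable {n : ℕ} {W : Type*} [Group W] (cs : CoxeterSystem (CoxeterMatrix.B n) W)

theorem exists_toVector_eq_ofPerm (w : W) :
    ∃ x : Equiv.Perm (Fin n) × (Fin n → Bool), cs.toVector w = ofPerm x.1 x.2 := by
  induction w using cs.simple_induction_left with
  | one => rw [toVector_one]; exact exists_ofPerm_base n
  | mul_simple_left w i ih =>
    obtain ⟨x, hx⟩ := ih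
    rw [toVector_simple_mul, hx]
    exact exists_ofPerm_reflect i.2 x.1 x.2

/-- The permutation and the signs describing a group element. -/
noncomputable def toPerm (w : W) : Equiv.Perm (Fin n) × (Fin n → Bool) :=
  (cs.exists_toVector_eq_ofPerm w).choose

theorem ofPerm_toPerm (w : W) : ofPerm (cs.toPerm w).1 (cs.toPerm w).2 = cs.toVector w :=
  (cs.exists_toVector_eq_ofPerm w).choose_spec.symm

/-- Injectivity alone gives finiteness and the upper bound `2 ^ n * n!` on the order, so
surjectivity is not needed. -/
theorem toPerm_injective : Function.Injective cs.toPerm := by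
  intro w w' h
  apply cs.toVector_injective
  rw [← ofPerm_toPerm, ← ofPerm_toPerm, h]

theorem finite_of_typeB (cs : CoxeterSystem (CoxeterMatrix.B n) W) : Finite W := Finite.of_injective _ cs.toPerm_injective

theorem card_typeB_le (cs : CoxeterSystem (CoxeterMatrix.B n) W) [Fintype W] :
    Fintype.card W ≤ 2 ^ n * n.factorial := by
  refine (Fintype.card_le_of_injective _ cs.toPerm_injective).trans (le_of_eq ?_)
  rw [Fintype.card_prod, Fintype.card_perm, Fintype.card_fun, Fintype.card_bool, Fintype.card_fin,
    mul_comm]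

theorem card_length_le_le (hn : 0 < n) :
    ({w : W | (cs.length w : ℝ) ≤ 0.4 * n ^ 2}.ncard : ℝ) ≤
      2 ^ n * n.factorial * Real.exp (-(0.005 * n)) := by
  refine le_trans ?_ (card_inv_ofPerm_le hn)
  rw [← Set.ncard_coe_finset]
  refine Nat.cast_le.2 (Set.ncard_le_ncard_of_injOn cs.toPerm ?_ cs.toPerm_injective.injOn
    (Finset.finite_toSet _))
  intro w hw
  simp only [Set.mem_ofPred_eq, Finset.coe_filter, Finset.mem_univ, true_and] at hw ⊢
  rwa [ofPerm_toPerm, ← length_eq_inv]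

theorem IsProper.length_le_or_le_numLeftDescents {w : W} (hw : cs.IsProper w) (hn : 65 ≤ n) :
    (cs.length w : ℝ) ≤ 0.4 * n ^ 2 ∨ (0.6 : ℝ) * n ≤ cs.numLeftDescents w := by
  by_contra! h
  obtain ⟨h1, h2⟩ := h
  have h3 := hw.trans (Nat.add_le_add_left (cs.maxw₀_le _) _)
  rw [Nat.card_fin] at h3
  have h4 : (cs.length w : ℝ) ≤ n + (cs.numLeftDescents w ^ 2 + cs.numLeftDescents w) := by
    exact_mod_cast h3
  have h5 : (65 : ℝ) ≤ n := by exact_mod_cast hn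
  have h6 : (0 : ℝ) ≤ cs.numLeftDescents w := Nat.cast_nonneg _
  -- The margin is `0.4 - 0.6² = 0.04`: the linear terms `1.6 n` are below `0.04 n²` once `n > 40`.
  nlinarith

theorem ncard_isProper_le (hn : 1000 ≤ n) :
    ({w : W | cs.IsProper w}.ncard : ℝ) ≤
      2 ^ n * n.factorial * Real.exp (-(0.001 * n)) := by
  have hfin := cs.finite_of_typeB
  have : Fintype W := Fintype.ofFinite W
  have hsub : {w : W | cs.IsProper w} ⊆ {w : W | (cs.length w : ℝ) ≤ 0.4 * n ^ 2} ∪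
      {w : W | (0.6 : ℝ) * n ≤ cs.numLeftDescents w} := fun w hw =>
    IsProper.length_le_or_le_numLeftDescents cs hw (by omega)
  have hle := (Set.ncard_le_ncard hsub (Set.toFinite _)).trans (Set.ncard_union_le _ _)
  have hle' : ({w : W | cs.IsProper w}.ncard : ℝ) ≤
      {w : W | (cs.length w : ℝ) ≤ 0.4 * n ^ 2}.ncard +
        {w : W | (0.6 : ℝ) * n ≤ cs.numLeftDescents w}.ncard := by exact_mod_cast hle
  have hA := cs.card_length_le_le (by omega)
  have hB := cs.card_numLeftDescents_ge_le
  have hW : (Fintype.card W : ℝ) ≤ 2 ^ n * n.factorial := by exact_mod_cast cs.card_typeB_le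
  have hn' : (1000 : ℝ) ≤ n := by exact_mod_cast hn
  have e1 : Real.exp (0.11 - 0.01 * n) ≤ Real.exp (-(0.005 * n)) :=
    Real.exp_le_exp.2 (by linarith)
  -- The 3 counts one length tail and two descent tails; lowering the rate to `0.001` absorbs it.
  have e2 : 3 * Real.exp (-(0.005 * n)) ≤ Real.exp (-(0.001 * n)) := by
    have h : (3 : ℝ) ≤ Real.exp (0.004 * n) := by
      have := Real.add_one_le_exp (0.004 * (n : ℝ))
      linarith
    refine (mul_le_mul_of_nonneg_right h (Real.exp_pos _).le).trans (le_of_eq ?_)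
    rw [← Real.exp_add]
    congr 1
    ring
  have hC : (Fintype.card W : ℝ) * Real.exp (0.11 - 0.01 * n) ≤
      2 ^ n * n.factorial * Real.exp (-(0.005 * n)) :=
    mul_le_mul hW e1 (Real.exp_pos _).le (by positivity)
  have hD := mul_le_mul_of_nonneg_left e2
    (show (0 : ℝ) ≤ 2 ^ n * n.factorial by positivity)
  linarith

end CoxeterSystem

theorem proposition5p4 :
    ∃ c : ℝ, 0 < c ∧ ∃ N : ℕ, ∀ n : ℕ, N ≤ n →
      ∀ (W : Type*) [Group W] (cs : CoxeterSystem (CoxeterMatrix.B n) W),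
        {w : W | cs.IsProper w}.Finite ∧
          ({w : W | cs.IsProper w}.ncard : ℝ) ≤
            (2 : ℝ) ^ n * (n.factorial : ℝ) * Real.exp (-(c * (n : ℝ))) := by
  refine ⟨0.001, by norm_num, 1000, fun n hn W _ cs => ⟨?_, cs.ncard_isProper_le hn⟩⟩
  have := cs.finite_of_typeB
  exact Set.toFinite _
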